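/- Let $M$ be a smooth $7$-manifold. A $\mathrm G_2$-structure on $M$ is a smooth $3$-form $\varphi$ which at every point $p$ can be written as $$\varphi|_p=e^{127}+e^{347}+e^{567}+e^{135}-e^{146}-e^{236}-e^{245}$$ with respect to some basis $(e^1,\dots,e^7)$ of $T_p^*M$, where $e^{ijk}=e^i\wedge e^j\wedge e^k$. It is locally conformal closed (LCC) with Lee form $\theta\in\Omega^1(M)$ if $d\varphi=\theta\wedge\varphi$ (such a $\theta$ is unique and closed). Put $d_\theta\alpha=d\alpha-\theta\wedge\alpha$, and let $\mathfrak{aut}(M,\varphi)$ be the space of smooth vector fields $X$ on $M$ with $\mathcal L_X\varphi=0$. The LCC structure $(\varphi,\theta)$ is of the first kind if $X\mapsto\theta(X)$ maps $\mathfrak{aut}(M,\varphi)$ onto $\mathbb R$, that is, if for every $c\in\mathbb R$ there is $X\in\mathfrak{aut}(M,\varphi)$ with $\theta(X)\equiv c$. It is exact of the first kind if $\varphi=d_\theta(\iota_X\varphi)$ for some smooth vector field $X$ with $\theta(X)\equiv-1$. **Proposition.** Let $(\varphi,\theta)$ be an LCC $\mathrm G_2$-structure on $M$. 1. For every smooth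 vector field $X$ on $M$, $$\varphi=d_\theta(\iota_X\varphi)\quad\Longleftrightarrow\quad \mathcal L_X\varphi=(\theta(X)+1)\,\varphi .$$ 2. If $X$ is a smooth vector field with $\varphi=d_\theta(\iota_X\varphi)$, then $\theta(X)\equiv-1$ (that is, $X$ exhibits $\varphi$ as exact of the first kind) if and only if $X\in\mathfrak{aut}(M,\varphi)$. 3. $(\varphi,\theta)$ is of the first kind if and only if it is exact of the first kind, and if and only if there is a smooth vector field $X$ with $\mathcal L_X\varphi=(\theta(X)+1)\,\varphi$ and $\theta(X)\equiv-1$. -/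

import Mathlib

open scoped Manifold ContDiff

noncomputable section

namespace LCCG2

/-! ### Linear algebra -/

section Linear

variable {V : Type*} [NormedAddCommGroup V] [NormedSpace ℝ V] {k : ℕ}

/-- The linear functional underlying an alternating `1`-form. -/
def toFunctional (α : V [⋀^Fin 1]→L[ℝ] ℝ) : V →L[ℝ] ℝ :=
  (ContinuousAlternatingMap.ofSubsingleton ℝ V ℝ (0 : Fin 1)).symm α

/-- The wedge product of a covector with a `k`-form, normalized by
`(α ∧ η)(v₀, …, v_k) = ∑ i, (-1)^i α(v_i) η(v₀, …, v̂_i, …, v_k)`. -/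
def wedge (α : V →L[ℝ] ℝ) (η : V [⋀^Fin k]→L[ℝ] ℝ) : V [⋀^Fin (k + 1)]→L[ℝ] ℝ :=
  ContinuousAlternatingMap.alternatizeUncurryFin (α.smulRight η)

theorem wedge_apply (α : V →L[ℝ] ℝ) (η : V [⋀^Fin k]→L[ℝ] ℝ) (v : Fin (k + 1) → V) :
    wedge α η v = ∑ i : Fin (k + 1), (-1) ^ (i : ℕ) * (α (v i) * η (i.removeNth v)) := by
  simp [wedge, ContinuousAlternatingMap.alternatizeUncurryFin_apply]

/-- The triple wedge product `α ∧ β ∧ γ` of three covectors. -/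
def wedge₃ (α β γ : V →L[ℝ] ℝ) : V [⋀^Fin 3]→L[ℝ] ℝ :=
  wedge α (wedge β (ContinuousAlternatingMap.ofSubsingleton ℝ V ℝ (0 : Fin 1) γ))

/-- The `3`-form `e¹²⁷ + e³⁴⁷ + e⁵⁶⁷ + e¹³⁵ - e¹⁴⁶ - e²³⁶ - e²⁴⁵` attached to seven covectors
`(e¹, …, e⁷)`, which are numbered from `0` to `6` here. -/
def g2Model (e : Fin 7 → V →L[ℝ] ℝ) : V [⋀^Fin 3]→L[ℝ] ℝ :=
  wedge₃ (e 0) (e 1) (e 6) + wedge₃ (e 2) (e 3) (e 6) + wedge₃ (e 4) (e 5) (e 6)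
    + wedge₃ (e 0) (e 2) (e 4) - wedge₃ (e 0) (e 3) (e 5) - wedge₃ (e 1) (e 2) (e 5)
    - wedge₃ (e 1) (e 3) (e 4)

/-- A `3`-form on a vector space is a G₂-form if it is the model form with respect to some basis of
the dual space. -/
def IsG2Form (ϕ : V [⋀^Fin 3]→L[ℝ] ℝ) : Prop :=
  ∃ e : Module.Basis (Fin 7) ℝ (V →L[ℝ] ℝ), ϕ = g2Model e

/-- The Lie derivative of a `k`-form `η` along a vector field `X` on a normed space, by the usual
coordinate formula, see `lieDerivFlat_apply`. The second summand is the derivative of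
`A ↦ (η y)(A ·, …, A ·)` at `A = id` in the direction `DX(y)`; thus the sum is the derivative at
`t = 0` of the pullback of `η` under the flow of `X`. -/
def lieDerivFlat (X : V → V) (η : V → V [⋀^Fin k]→L[ℝ] ℝ) (y : V) : V [⋀^Fin k]→L[ℝ] ℝ :=
  fderiv ℝ η y (X y)
    + (η y).fderivCompContinuousLinearMap (ContinuousLinearMap.id ℝ V) (fderiv ℝ X y)

theorem lieDerivFlat_apply (X : V → V) (η : V → V [⋀^Fin k]→L[ℝ] ℝ) (y : V) (v : Fin k → V) :
    lieDerivFlat X η y v =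
      fderiv ℝ η y (X y) v + ∑ i, η y (Function.update v i (fderiv ℝ X y (v i))) := by
  simp only [lieDerivFlat, ContinuousAlternatingMap.add_apply,
    ContinuousAlternatingMap.fderivCompContinuousLinearMap_apply]
  congr 1
  refine Finset.sum_congr rfl fun i _ => ?_
  congr 1
  funext j
  rcases eq_or_ne j i with rfl | h
  · simp
  · simp [Function.update_of_ne h]

end Linear

/-! ### Differential forms on a `7`-manifold

Tangent spaces are modelled on `ℝ⁷`; `TangentSpace (𝓡 7) p` is identified with `ℝ⁷` through the
preferred chart at `p`, as everywhere in Mathlib. -/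

/-- The model space `ℝ⁷`. -/
abbrev R7 : Type := EuclideanSpace ℝ (Fin 7)

section Manifold

variable (M : Type*) [TopologicalSpace M] [ChartedSpace R7 M]

/-- (Not necessarily smooth) differential `k`-forms on `M`. -/
abbrev DForm (k : ℕ) : Type _ := (p : M) → TangentSpace (𝓡 7) p [⋀^Fin k]→L[ℝ] ℝ

/-- (Not necessarily smooth) vector fields on `M`. -/
abbrev VField : Type _ := (p : M) → TangentSpace (𝓡 7) p

variable {M} {k : ℕ}

/-- Smooth vector fields, as sections of the tangent bundle. -/
def IsSmoothVField [IsManifold (𝓡 7) ∞ M] (X : VField M) : Prop :=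
  ContMDiff (𝓡 7) (𝓡 7).tangent ∞ (fun p => (⟨p, X p⟩ : TangentBundle (𝓡 7) M))

/-- The local expression on `ℝ⁷` of a form in the preferred chart at `p₀`: its pullback by the
inverse of that chart. -/
def localForm (η : DForm M k) (p₀ : M) (y : R7) : R7 [⋀^Fin k]→L[ℝ] ℝ :=
  (η ((extChartAt (𝓡 7) p₀).symm y)).compContinuousLinearMap
    (mfderiv 𝓘(ℝ, R7) (𝓡 7) (extChartAt (𝓡 7) p₀).symm y)

/-- The local expression on `ℝ⁷` of a vector field in the preferred chart at `p₀`: its pullback by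
the inverse of that chart. -/
def localVField (X : VField M) (p₀ : M) : R7 → R7 :=
  VectorField.mpullback 𝓘(ℝ, R7) (𝓡 7) (extChartAt (𝓡 7) p₀).symm X

/-- Smooth forms: all local expressions are smooth. -/
def IsSmoothForm (η : DForm M k) : Prop :=
  ∀ p₀ : M, ContDiffOn ℝ ∞ (localForm η p₀) (extChartAt (𝓡 7) p₀).target

/-- A form on `ℝ⁷` at the image of `p` in the preferred chart at `p`, pulled back to `T_pM`. -/
def pullToPoint (p : M) (η : R7 [⋀^Fin k]→L[ℝ] ℝ) : TangentSpace (𝓡 7) p [⋀^Fin k]→L[ℝ] ℝ :=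
  η.compContinuousLinearMap (mfderiv (𝓡 7) 𝓘(ℝ, R7) (extChartAt (𝓡 7) p) p)

/-- The exterior derivative `dη`. -/
def extD (η : DForm M k) : DForm M (k + 1) := fun p =>
  pullToPoint p (extDeriv (localForm η p) (extChartAt (𝓡 7) p p))

/-- The Lie derivative `L_X η`. -/
def lieD (X : VField M) (η : DForm M k) : DForm M k := fun p =>
  pullToPoint p (lieDerivFlat (localVField X p) (localForm η p) (extChartAt (𝓡 7) p p))

/-- The contraction `ι_X η = η(X, ·, …, ·)`. -/
def contract (X : VField M) (η : DForm M (k + 1)) : DForm M k := fun p =>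
  ContinuousAlternatingMap.curryLeft (E := R7) (η p) (X p)

/-- The wedge product `θ ∧ η` of a `1`-form with a `k`-form. -/
def wedgeForm (θ : DForm M 1) (η : DForm M k) : DForm M (k + 1) := fun p =>
  wedge (V := R7) (toFunctional (V := R7) (θ p)) (η p)

/-- The function `θ(X)`. -/
def pairing (θ : DForm M 1) (X : VField M) (p : M) : ℝ := θ p (fun _ => X p)

/-- The Lichnerowicz differential `d_θ η = dη - θ ∧ η`. -/
def lichD (θ : DForm M 1) (η : DForm M k) : DForm M (k + 1) := extD η - wedgeForm θ η

/-- A G₂-structure on `M`: a smooth `3`-form which is a G₂-form at each point. -/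
structure IsG2Structure (φ : DForm M 3) : Prop where
  smooth : IsSmoothForm φ
  isG2Form : ∀ p, IsG2Form (V := R7) (φ p)

/-- `(φ, θ)` is a locally conformal closed G₂-structure: `dφ = θ ∧ φ`.
(Such a `θ` is automatically unique and closed.) -/
structure IsLCC (φ : DForm M 3) (θ : DForm M 1) : Prop where
  isG2Structure : IsG2Structure φ
  smooth_lee : IsSmoothForm θ
  extD_eq : extD φ = wedgeForm θ φ

/-- `X` is an infinitesimal automorphism of `φ`, i.e. `X ∈ 𝔞𝔲𝔱(M, φ)`. -/
structure IsInfAut [IsManifold (𝓡 7) ∞ M] (φ : DForm M 3) (X : VField M) : Prop where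
  smooth : IsSmoothVField X
  lieD_eq_zero : lieD X φ = 0

/-- `(φ, θ)` is of the first kind: `X ↦ θ(X)` maps `𝔞𝔲𝔱(M, φ)` onto the real numbers (seen as
constant functions on `M`). -/
def IsFirstKind [IsManifold (𝓡 7) ∞ M] (φ : DForm M 3) (θ : DForm M 1) : Prop :=
  ∀ c : ℝ, ∃ X : VField M, IsInfAut φ X ∧ ∀ p, pairing θ X p = c

/-- `φ` is exact of the first kind: `φ = d_θ(ι_X φ)` for a vector field `X` with `θ(X) = -1`. -/
def IsExactFirstKind [IsManifold (𝓡 7) ∞ M] (φ : DForm M 3)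
    (θ : DForm M 1) : Prop :=
  ∃ X : VField M, IsSmoothVField X ∧ φ = lichD θ (contract X φ) ∧ ∀ p, pairing θ X p = -1

end Manifold

end LCCG2

end

/-! Everything follows from `L_X φ = d_θ(ι_X φ) + θ(X) φ`: insert `dφ = θ ∧ φ` into Cartan's formula
and use that `ι_X` is an antiderivation. Cancelling `θ(X) φ` gives the first equivalence. The second
holds because `φ` vanishes nowhere, the third because `𝔞𝔲𝔱(M, φ)` is closed under real scaling. The
antiderivation rule and the flat Cartan formula both come from the algebraic identity below. The
flat formula passes to `M` one point at a time, in the preferred chart at that point. -/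

open ContinuousAlternatingMap in
/-- Contracting the alternatization of `D` with `x`, plus alternatizing the contraction of `D`
with `x`, gives `D x`. -/
theorem curryLeft_alternatizeUncurryFin_add {E F : Type*} [NormedAddCommGroup E] [NormedSpace ℝ E]
    [NormedAddCommGroup F] [NormedSpace ℝ F] {n : ℕ} (D : E →L[ℝ] E [⋀^Fin (n + 1)]→L[ℝ] F)
    (x : E) (D' : E →L[ℝ] E [⋀^Fin n]→L[ℝ] F) (hD' : ∀ v, D' v = (D v).curryLeft x) :
    alternatizeUncurryFin D' + (alternatizeUncurryFin D).curryLeft x = D x := by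
  ext v
  have h : ∀ i : Fin (n + 1), (i.succ.removeNth (Matrix.vecCons x v) : Fin (n + 1) → E) =
      Matrix.vecCons x (i.removeNth v) := by
    intro i
    funext j
    cases j using Fin.cases <;> simp [Fin.removeNth]
  simp only [ContinuousAlternatingMap.add_apply, curryLeft_apply_apply,
    alternatizeUncurryFin_apply, hD']
  -- The term of index `0` is `D x v`; the term of index `i + 1` is minus the `i`-th term of the
  -- alternatization of `D'`.
  rw [Fin.sum_univ_succ (n := n + 1)]
  simp only [h, Matrix.cons_val_succ, Fin.val_succ, pow_succ, mul_neg, mul_one, neg_smul,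
    Finset.sum_neg_distrib, Matrix.cons_val_zero, Fin.val_zero, pow_zero, one_smul]
  have h0 : (Fin.removeNth (0 : Fin (n + 2)) (Matrix.vecCons x v) : Fin (n + 1) → E) = v := by
    funext j; simp [Fin.removeNth]
  rw [h0]
  abel

namespace LCCG2

/-! ### Pointwise algebra and Cartan's formula on a normed space -/

section Linear

variable {V : Type*} [NormedAddCommGroup V] [NormedSpace ℝ V] {k : ℕ}

/-- Contraction is an antiderivation: `ι_x (α ∧ η) = α(x) η - α ∧ ι_x η`. -/
theorem curryLeft_wedge (α : V →L[ℝ] ℝ) (η : V [⋀^Fin (k + 1)]→L[ℝ] ℝ) (x : V) :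
    (wedge α η).curryLeft x = α x • η - wedge α (η.curryLeft x) := by
  exact eq_sub_of_add_eq' (curryLeft_alternatizeUncurryFin_add (α.smulRight η) x
    (α.smulRight (η.curryLeft x)) fun v => rfl)

/-- Cartan's formula on a normed space. -/
theorem lieDerivFlat_eq {X : V → V} {η : V → V [⋀^Fin (k + 1)]→L[ℝ] ℝ} {y : V}
    (hX : DifferentiableAt ℝ X y) (hη : DifferentiableAt ℝ η y) :
    lieDerivFlat X η y =
      extDeriv (fun z => (η z).curryLeft (X z)) y + (extDeriv η y).curryLeft (X y) := by
  let c := (ContinuousAlternatingMap.curryLeftLI (𝕜 := ℝ) (E := V) (F := ℝ)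
    (n := k)).toContinuousLinearMap
  -- Product rule for `ι_X η`: alternatizing the first summand gives the `DX` term of the Lie
  -- derivative (`h2`); the second, together with `ι_X dη`, gives the derivative of `η` along `X`
  -- (`h1`).
  have hd : HasFDerivAt (fun z => (η z).curryLeft (X z))
      ((η y).curryLeft ∘L fderiv ℝ X y + (c ∘L fderiv ℝ η y).flip (X y)) y :=
    HasFDerivAt.clm_apply (c := fun z => (η z).curryLeft)
      (HasFDerivAt.comp (g := c) y c.hasFDerivAt hη.hasFDerivAt) hX.hasFDerivAt
  have h1 := curryLeft_alternatizeUncurryFin_add (fderiv ℝ η y) (X y)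
    ((c ∘L fderiv ℝ η y).flip (X y)) fun v => rfl
  have h2 : (η y).fderivCompContinuousLinearMap (ContinuousLinearMap.id ℝ V) (fderiv ℝ X y) =
      ContinuousAlternatingMap.alternatizeUncurryFin ((η y).curryLeft ∘L fderiv ℝ X y) := by
    rw [ContinuousAlternatingMap.fderivCompContinuousLinearMap_eq_alternatizeUncurryFin]
    rfl
  rw [lieDerivFlat, extDeriv, extDeriv, hd.fderiv,
    ContinuousAlternatingMap.alternatizeUncurryFin_add, h2, ← h1]
  abel

theorem lieDerivFlat_const_smul (c : ℝ) (X : V → V) (η : V → V [⋀^Fin k]→L[ℝ] ℝ) (y : V) :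
    lieDerivFlat (c • X) η y = c • lieDerivFlat X η y := by
  rw [lieDerivFlat, lieDerivFlat, fderiv_const_smul_field, Pi.smul_apply, Pi.smul_apply, map_smul,
    map_smul, smul_add]

theorem wedge₃_apply (α β γ : V →L[ℝ] ℝ) (v : Fin 3 → V) :
    wedge₃ α β γ v = α (v 0) * (β (v 1) * γ (v 2) - β (v 2) * γ (v 1))
      - α (v 1) * (β (v 0) * γ (v 2) - β (v 2) * γ (v 0))
      + α (v 2) * (β (v 0) * γ (v 1) - β (v 1) * γ (v 0)) := by
  simp [wedge₃, wedge_apply, Fin.sum_univ_succ, Fin.removeNth, Fin.succAbove]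
  ring

/-- By reflexivity, `e` is dual to a family `w` of vectors of `V`, on which the model form can be
evaluated. -/
theorem IsG2Form.ne_zero [FiniteDimensional ℝ V] {ϕ : V [⋀^Fin 3]→L[ℝ] ℝ} (h : IsG2Form ϕ) :
    ϕ ≠ 0 := by
  obtain ⟨e, rfl⟩ := h
  let b : Module.Basis (Fin 7) ℝ (Module.Dual ℝ V) :=
    e.map (LinearMap.toContinuousLinearMap (𝕜 := ℝ) (E := V) (F' := ℝ)).symm
  let w : Fin 7 → V := fun i => (Module.evalEquiv ℝ V).symm (b.dualBasis i)
  have hw : ∀ i j, e i (w j) = if i = j then 1 else 0 := fun i j => by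
    have h1 : e i (w j) = b i (w j) := by simp [b]
    rw [h1, Module.apply_evalEquiv_symm_apply, b.dualBasis_apply_self]
  intro h0
  -- Only `e¹²⁷` is nonzero on these three vectors, and its value is `1`.
  have h1 := congrArg (fun ψ : V [⋀^Fin 3]→L[ℝ] ℝ => ψ ![w 0, w 1, w 6]) h0
  simp [g2Model, wedge₃_apply, hw] at h1

end Linear

/-! ### Transfer to the manifold and the proposition -/

section Manifold

variable {M : Type*} [TopologicalSpace M] [ChartedSpace R7 M] {k : ℕ}

theorem lieD_const_smul (c : ℝ) (X : VField M) (η : DForm M k) :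
    lieD (c • X) η = c • lieD X η := by
  funext p
  have h : localVField (c • X) p = c • localVField X p := VectorField.mpullback_const_smul
  simp only [lieD, h, lieDerivFlat_const_smul, Pi.smul_apply]
  rfl

theorem pairing_const_smul (θ : DForm M 1) (c : ℝ) (X : VField M) (p : M) :
    pairing θ (c • X) p = c * pairing θ X p := by
  have h := (toFunctional (V := R7) (θ p)).map_smul c (X p)
  exact h

theorem IsSmoothForm.differentiableAt_localForm {η : DForm M k} (hη : IsSmoothForm η) (p : M) :
    DifferentiableAt ℝ (localForm η p) (extChartAt (𝓡 7) p p) :=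
  ((hη p).contDiffAt ((isOpen_extChartAt_target p).mem_nhds
    (mem_extChartAt_target p))).differentiableAt (by simp)

theorem contract_wedgeForm (X : VField M) (θ : DForm M 1) (η : DForm M (k + 1)) :
    contract X (wedgeForm θ η) = (fun p => pairing θ X p • η p) - wedgeForm θ (contract X η) :=
  funext fun _ => curryLeft_wedge (V := R7) _ _ _

theorem IsG2Structure.apply_ne_zero {φ : DForm M 3} (h : IsG2Structure φ) (p : M) : φ p ≠ 0 :=
  (h.isG2Form p).ne_zero

variable [IsManifold (𝓡 7) ∞ M]

theorem IsSmoothVField.const_smul {X : VField M} (hX : IsSmoothVField X) (c : ℝ) :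
    IsSmoothVField (c • X) :=
  ContMDiff.const_smul_section hX

theorem isInvertible_mfderiv_extChartAt_symm {p : M} {y : R7}
    (hy : y ∈ (extChartAt (𝓡 7) p).target) :
    (mfderiv 𝓘(ℝ, R7) (𝓡 7) (extChartAt (𝓡 7) p).symm y).IsInvertible := by
  have : IsManifold (𝓡 7) 1 M := .of_le (n := ∞) (by simp)
  have h := isInvertible_mfderivWithin_extChartAt_symm (I := 𝓡 7) hy
  rwa [ModelWithCorners.range_eq_univ, mfderivWithin_univ] at h

/-- Pullback commutes with contraction because `A (A⁻¹ X) = X` for the differential `A` of the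
inverse chart; this needs `A` invertible, since `inverse` defaults to `0`. -/
theorem localForm_contract (X : VField M) (η : DForm M (k + 1)) {p : M} {y : R7}
    (hy : y ∈ (extChartAt (𝓡 7) p).target) :
    localForm (contract X η) p y = (localForm η p y).curryLeft (localVField X p y) := by
  have hA := (isInvertible_mfderiv_extChartAt_symm hy).self_apply_inverse
    (X ((extChartAt (𝓡 7) p).symm y))
  ext v
  refine congrArg (η ((extChartAt (𝓡 7) p).symm y)) (funext fun i => ?_)
  cases i using Fin.cases with
  | zero => exact hA.symm
  | succ i => rfl

theorem mfderiv_extChartAt_apply (X : VField M) (p : M) :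
    mfderiv (𝓡 7) 𝓘(ℝ, R7) (extChartAt (𝓡 7) p) p (X p) =
      localVField X p (extChartAt (𝓡 7) p p) := by
  have : IsManifold (𝓡 7) 1 M := .of_le (n := ∞) (by simp)
  have hA := isInvertible_mfderiv_extChartAt_symm (mem_extChartAt_target (I := 𝓡 7) p)
  have hAB := mfderivWithin_extChartAt_symm_comp_mfderiv_extChartAt' (I := 𝓡 7)
    (mem_extChartAt_source (I := 𝓡 7) p)
  rw [ModelWithCorners.range_eq_univ, mfderivWithin_univ] at hAB
  rw [localVField, VectorField.mpullback_apply, eq_comm, hA.inverse_apply_eq]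
  exact (congrArg (fun q => (X q : R7)) (extChartAt_to_inv (I := 𝓡 7) p)).trans
    (DFunLike.congr_fun hAB (X p)).symm

theorem IsSmoothVField.differentiableAt_localVField {X : VField M} (hX : IsSmoothVField X) (p : M) :
    DifferentiableAt ℝ (localVField X p) (extChartAt (𝓡 7) p p) := by
  have h := ContMDiffAt.mpullback_vectorField_preimage (m := ∞) (n := ∞)
    (f := (extChartAt (𝓡 7) p).symm) (x₀ := extChartAt (𝓡 7) p p) (hX _)
    ((contMDiffOn_extChartAt_symm p).contMDiffAt
      ((isOpen_extChartAt_target p).mem_nhds (mem_extChartAt_target p)))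
    (isInvertible_mfderiv_extChartAt_symm (mem_extChartAt_target p)) le_rfl
  exact (contMDiffAt_vectorSpace_iff_contDiffAt.1 h).differentiableAt (by simp)

/-- Cartan's formula. -/
theorem lieD_eq {X : VField M} {η : DForm M (k + 1)} (hX : IsSmoothVField X)
    (hη : IsSmoothForm η) : lieD X η = extD (contract X η) + contract X (extD η) := by
  funext p
  -- Agreement near the image of `p` suffices, as the exterior derivative depends only on the germ.
  have h1 : localForm (contract X η) p =ᶠ[nhds (extChartAt (𝓡 7) p p)]
      fun y => (localForm η p y).curryLeft (localVField X p y) :=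
    Filter.eventually_of_mem ((isOpen_extChartAt_target p).mem_nhds (mem_extChartAt_target p))
      fun y hy => localForm_contract X η hy
  have h2 := lieDerivFlat_eq (hX.differentiableAt_localVField p) (hη.differentiableAt_localForm p)
  rw [← h1.extDeriv_eq, ← mfderiv_extChartAt_apply] at h2
  rw [lieD, h2]
  exact congrArg (pullToPoint p (extDeriv (localForm (contract X η) p) (extChartAt (𝓡 7) p p)) + ·)
    (ContinuousAlternatingMap.curryLeft_compContinuousLinearMap (E := R7) _ _ _).symm

/-- On a locally conformal closed G₂-structure, `L_X φ = d_θ (ι_X φ) + θ(X) φ`. -/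
theorem IsLCC.lieD_eq {φ : DForm M 3} {θ : DForm M 1} (h : IsLCC φ θ) {X : VField M}
    (hX : IsSmoothVField X) :
    lieD X φ = lichD θ (contract X φ) + fun p => pairing θ X p • φ p := by
  rw [LCCG2.lieD_eq hX h.isG2Structure.smooth, h.extD_eq, contract_wedgeForm, lichD]
  abel

theorem IsLCC.eq_lichD_contract_iff {φ : DForm M 3} {θ : DForm M 1} (h : IsLCC φ θ) {X : VField M}
    (hX : IsSmoothVField X) :
    φ = lichD θ (contract X φ) ↔ lieD X φ = fun p => (pairing θ X p + 1) • φ p := by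
  have h1 : (fun p => (pairing θ X p + 1) • φ p) = φ + fun p => pairing θ X p • φ p := by
    funext p
    exact (add_smul _ _ _).trans ((add_comm _ _).trans (congrArg (· + _) (one_smul ℝ (φ p))))
  rw [h.lieD_eq hX, h1, add_left_inj, eq_comm]

theorem IsLCC.pairing_eq_neg_one_iff {φ : DForm M 3} {θ : DForm M 1} (h : IsLCC φ θ) {X : VField M}
    (hX : IsSmoothVField X) (hφ : φ = lichD θ (contract X φ)) :
    (∀ p, pairing θ X p = -1) ↔ IsInfAut φ X := by
  have hL := (h.eq_lichD_contract_iff hX).1 hφ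
  refine ⟨fun hp => ⟨hX, ?_⟩, fun hA p => ?_⟩
  · rw [hL]
    funext p
    rw [hp p, neg_add_cancel]
    exact zero_smul ℝ (φ p)
  · have h0 : (pairing θ X p + 1) • φ p = 0 := congrFun (hL.symm.trans hA.lieD_eq_zero) p
    have := (smul_eq_zero.1 h0).resolve_right (h.isG2Structure.apply_ne_zero p)
    linarith

theorem IsLCC.isFirstKind_iff {φ : DForm M 3} {θ : DForm M 1} (h : IsLCC φ θ) :
    IsFirstKind φ θ ↔ IsExactFirstKind φ θ := by
  constructor
  · intro hf
    obtain ⟨X, hX, hp⟩ := hf (-1)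
    refine ⟨X, hX.smooth, (h.eq_lichD_contract_iff hX.smooth).2 ?_, hp⟩
    rw [hX.lieD_eq_zero]
    funext p
    rw [hp p, neg_add_cancel]
    exact (zero_smul ℝ (φ p)).symm
  · rintro ⟨X, hX, hφ, hp⟩ c
    have hA := (h.pairing_eq_neg_one_iff hX hφ).1 hp
    -- Since `θ(X) = -1`, the factor `-c` produces the value `c`.
    refine ⟨(-c) • X, ⟨hX.const_smul _, ?_⟩, fun p => ?_⟩
    · rw [lieD_const_smul, hA.lieD_eq_zero, smul_zero]
    · rw [pairing_const_smul, hp p]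
      ring

end Manifold

end LCCG2

theorem proposition4p3 {M : Type*} [TopologicalSpace M]
    [ChartedSpace (EuclideanSpace ℝ (Fin 7)) M] [IsManifold (𝓡 7) ∞ M]
    (φ : LCCG2.DForm M 3) (θ : LCCG2.DForm M 1) (h : LCCG2.IsLCC φ θ) :
    -- the equivalence, for every vector field
    (∀ X : LCCG2.VField M, LCCG2.IsSmoothVField X →
      (φ = LCCG2.lichD θ (LCCG2.contract X φ) ↔
        LCCG2.lieD X φ = fun p => (LCCG2.pairing θ X p + 1) • φ p)) ∧
    -- if `φ = d_θ(ι_X φ)`, then `θ(X) = -1` exactly when `X` is an infinitesimal automorphism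
    (∀ X : LCCG2.VField M, LCCG2.IsSmoothVField X → φ = LCCG2.lichD θ (LCCG2.contract X φ) →
      ((∀ p, LCCG2.pairing θ X p = -1) ↔ LCCG2.IsInfAut φ X)) ∧
    -- `φ` is of the first kind, in either sense, exactly when `X` as above with `θ(X) = -1` exists
    (LCCG2.IsFirstKind φ θ ↔ LCCG2.IsExactFirstKind φ θ) ∧
    (LCCG2.IsExactFirstKind φ θ ↔ ∃ X : LCCG2.VField M, LCCG2.IsSmoothVField X ∧
      LCCG2.lieD X φ = (fun p => (LCCG2.pairing θ X p + 1) • φ p) ∧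
      ∀ p, LCCG2.pairing θ X p = -1) := by
  refine ⟨fun X hX => h.eq_lichD_contract_iff hX, fun X hX => h.pairing_eq_neg_one_iff hX,
    h.isFirstKind_iff, exists_congr fun X => and_congr_right fun hX => ?_⟩
  rw [h.eq_lichD_contract_iff hX]
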